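/- Let $\mathcal P$ be the class of compact Lie groups that are finite products of groups of the form $SU(r)$, $U(q)$ and $Sp(k)$, where $Sp(k)$ is the group of quaternionic unitary $k\times k$ matrices. Let $\pi$ be a finitely generated abelian group and let $G\in\mathcal P$. Give $\operatorname{Hom}(\pi,G)$ the subspace topology from $G^n$ determined by a finite generating family $e_1,\dots,e_n$ of $\pi$ (via $f\mapsto (f(e_1),\dots,f(e_n))$; it does not depend on the choice of generators), and let $G$ act on it by conjugation, $(g\cdot f)(x)=g\,f(x)\,g^{-1}$. Then this action has connected maximal rank isotropy subgroups: for every $f\in\operatorname{Hom}(\pi,G)$ the isotropy group $G_f=\{g\in G : g\cdot f=f\}$ is connected, and there is a maximal torus $T_f$ of $G$ (a subgroup isomorphic to $(S^1)^m$ for some $m\ge 0$, maximal with respect to inclusion among such subgroups) with $T_f\subseteq G_f$. -/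

import Mathlib

open scoped Quaternion

/-! ### The class of finite products of the groups `SU(r)`, `U(q)` and `Sp(k)` -/

/-- The special unitary group `SU(r)`. -/
abbrev SUGroup (r : ℕ) : Type := Matrix.specialUnitaryGroup (Fin r) ℂ

/-- The unitary group `U(q)`. -/
abbrev UGroup (q : ℕ) : Type := Matrix.unitaryGroup (Fin q) ℂ

/-- The compact symplectic group `Sp(k)`: the quaternionic `k × k` matrices `A` with
`A⋆ A = A A⋆ = 1`, where `A⋆` is the conjugate transpose. -/
abbrev SpGroup (k : ℕ) : Type := unitary (Matrix (Fin k) (Fin k) ℍ[ℝ])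

/-- `G` is, as a topological group, a finite (possibly empty) product of groups `SU(r i)`,
`U(q j)` and `Sp(k l)`. (Lie groups that are isomorphic as topological groups are isomorphic
as Lie groups.) -/
def InClassP (G : Type*) [Group G] [TopologicalSpace G] : Prop :=
  ∃ (a b c : ℕ) (r : Fin a → ℕ) (q : Fin b → ℕ) (k : Fin c → ℕ),
    Nonempty (G ≃ₜ*
      ((∀ i, SUGroup (r i)) × (∀ j, UGroup (q j)) × (∀ l, SpGroup (k l))))

/-! ### Maximal tori and connected maximal rank isotropy -/

/-- A subgroup that, with the subspace topology, is isomorphic as a topological group to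
`(S¹)ⁿ` for some `n ≥ 0`. -/
def IsTorusSubgroup {G : Type*} [Group G] [TopologicalSpace G] (T : Subgroup G) : Prop :=
  ∃ n : ℕ, Nonempty (T ≃ₜ* (Fin n → Circle))

/-- A maximal torus of `G`: a torus that is maximal with respect to inclusion. -/
def IsMaximalTorus {G : Type*} [Group G] [TopologicalSpace G] (T : Subgroup G) : Prop :=
  Maximal IsTorusSubgroup T

/-- The action of `G` on the `G`-space `X` has connected maximal rank isotropy subgroups. -/
def HasConnectedMaximalRankIsotropy (G X : Type*) [Group G] [TopologicalSpace G]
    [TopologicalSpace X] [MulAction G X] [ContinuousSMul G X] : Prop :=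
  ∀ x : X, IsConnected (MulAction.stabilizer G x : Set G) ∧
    ∃ T : Subgroup G, IsMaximalTorus T ∧ T ≤ MulAction.stabilizer G x

/-! ### The space of homomorphisms with the conjugation action -/

/-- The space `Hom(π, G)`. -/
def HomSpace (π G : Type*) [Group π] [Group G] : Type _ := π →* G

namespace HomSpace

variable {π G : Type*} [Group π] [Group G]

instance : FunLike (HomSpace π G) π G := inferInstanceAs (FunLike (π →* G) π G)

instance : MonoidHomClass (HomSpace π G) π G := inferInstanceAs (MonoidHomClass (π →* G) π G)

/-- The topology of pointwise convergence. If `π` is finitely generated, it is the subspace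
topology from `Gⁿ` for any finite generating family, see `isInducing_eval` below. -/
instance [TopologicalSpace G] : TopologicalSpace (HomSpace π G) :=
  TopologicalSpace.induced (fun f : HomSpace π G => (f : π → G)) inferInstance

/-- `G` acts on `Hom(π, G)` by conjugation: `(g • f) x = g * f x * g⁻¹`. -/
instance : MulAction G (HomSpace π G) where
  smul g f := (MulAut.conj g).toMonoidHom.comp (show π →* G from f)
  one_smul f := DFunLike.ext _ _ fun x => show 1 * f x * 1⁻¹ = f x by simp
  mul_smul g h f := DFunLike.ext _ _ fun x =>
    show g * h * f x * (g * h)⁻¹ = g * (h * f x * h⁻¹) * g⁻¹ by group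

theorem smul_apply (g : G) (f : HomSpace π G) (x : π) : (g • f) x = g * f x * g⁻¹ := rfl

theorem continuous_coe [TopologicalSpace G] :
    Continuous (fun f : HomSpace π G => (f : π → G)) := continuous_induced_dom

instance [TopologicalSpace G] [IsTopologicalGroup G] : ContinuousSMul G (HomSpace π G) where
  continuous_smul := by
    refine continuous_induced_rng.2 (continuous_pi fun x => ?_)
    have h : Continuous fun p : G × HomSpace π G => p.2 x :=
      (continuous_apply x).comp (continuous_coe.comp continuous_snd)
    exact (continuous_fst.mul h).mul continuous_fst.inv

/-- The topology of `Hom(π, G)` is the subspace topology from `Gⁿ` given by any finite family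
of generators of `π`. -/
theorem isInducing_eval [TopologicalSpace G] [IsTopologicalGroup G] {n : ℕ} (e : Fin n → π)
    (he : Subgroup.closure (Set.range e) = ⊤) :
    Topology.IsInducing (fun (f : HomSpace π G) (i : Fin n) => f (e i)) := by
  refine ⟨le_antisymm ?_ ?_⟩
  · exact continuous_iff_le_induced.1
      (continuous_pi fun i => (continuous_apply (e i)).comp continuous_coe)
  · let t : TopologicalSpace (HomSpace π G) := TopologicalSpace.induced
      (fun (f : HomSpace π G) (i : Fin n) => f (e i)) inferInstance
    refine continuous_iff_le_induced.1 (continuous_pi fun x => ?_)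
    have hx : x ∈ Subgroup.closure (Set.range e) := he ▸ Subgroup.mem_top x
    induction hx using Subgroup.closure_induction with
    | mem y hy =>
      obtain ⟨i, rfl⟩ := hy
      exact (continuous_apply i).comp
        (continuous_induced_dom (f := fun (f : HomSpace π G) (i : Fin n) => f (e i)))
    | one => simpa using continuous_const
    | mul y z _ _ hy hz =>
      simp only [map_mul]
      exact hy.mul hz
    | inv y _ hy =>
      simp only [map_inv]
      exact hy.inv

end HomSpace

/-! The isotropy group of `f` is the centralizer of the commuting set `A = f(π)`. Everything follows
from one property of `G`: it has a torus `T` that is its own centralizer and into which every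
commuting subset can be conjugated (`HasAbsorbingTorus`). If `g` centralizes `A`, then `A ∪ {g}`
still commutes, so it lies in a conjugate of `T`; this conjugate is connected, contains `1` and `g`,
and centralizes `A`. Hence the centralizer is connected. A conjugate of `T` containing `A` is a
maximal torus inside it (`isConnected_centralizer`).

The property passes to products and along isomorphisms, which leaves `U(q)`, `Sp(k)` and `SU(r)`.
There it is simultaneous unitary diagonalization (`exists_unitary_forall_eq_diagonal`): a common
unit eigenvector is moved to the first basis vector, the matrices become block diagonal, and
induction applies. `ℂ` and `ℍ` are treated together; over `ℍ` right eigenvectors with eigenvalues in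
`ℂ` are used. For `SU(r)` the diagonalizing matrix is corrected to determinant one. -/

open scoped Matrix

/-! ### Groups with a torus that absorbs all commuting subsets up to conjugation -/

/-- `G` contains a torus which equals its own centralizer and into which every commuting subset
of `G` can be conjugated. -/
def HasAbsorbingTorus (G : Type*) [Group G] [TopologicalSpace G] : Prop :=
  ∃ (ι : Type) (_ : Finite ι) (φ : (ι → Circle) →* G), Continuous φ ∧ Function.Injective φ ∧
    (∀ g, (∀ z, Commute g (φ z)) → g ∈ φ.range) ∧
    ∀ A : Set G, (∀ a ∈ A, ∀ b ∈ A, Commute a b) → ∃ g, ∀ a ∈ A, g⁻¹ * a * g ∈ φ.range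

/-- A continuous bijection from a compact space to a Hausdorff space is a homeomorphism. -/
theorem isTorusSubgroup_range {G ι : Type*} [Group G] [TopologicalSpace G] [T2Space G] [Finite ι]
    (φ : (ι → Circle) →* G) (hc : Continuous φ) (hi : Function.Injective φ) :
    IsTorusSubgroup φ.range := by
  obtain ⟨n, ⟨e⟩⟩ := Finite.exists_equiv_fin ι
  let ψ : (Fin n → Circle) →* (ι → Circle) :=
    { toFun := fun z i => z (e i), map_one' := rfl, map_mul' := fun _ _ => rfl }
  have hψ : Continuous ψ := continuous_pi fun i => continuous_apply (e i)
  let χ : (Fin n → Circle) →* φ.range := φ.rangeRestrict.comp ψ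
  have hχ : Continuous χ := (hc.comp hψ).subtype_mk _
  have hb : Function.Bijective χ := by
    constructor
    · intro z w h
      have h' : ψ z = ψ w := hi (congrArg Subtype.val h)
      funext j
      simpa [ψ] using congrFun h' (e.symm j)
    · rintro ⟨_, z, rfl⟩
      refine ⟨fun j => z (e.symm j), Subtype.ext (congrArg φ (funext fun i => ?_))⟩
      simp [ψ]
  let E : (Fin n → Circle) ≃* φ.range := MulEquiv.ofBijective χ hb
  let H := Continuous.homeoOfEquivCompactToT2 (f := E.toEquiv) hχ
  exact ⟨n, ⟨ContinuousMulEquiv.symm { E with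
    continuous_toFun := hχ
    continuous_invFun := H.symm.continuous }⟩⟩

theorem IsTorusSubgroup.commute {G : Type*} [Group G] [TopologicalSpace G] {T : Subgroup G}
    (hT : IsTorusSubgroup T) {a b : G} (ha : a ∈ T) (hb : b ∈ T) : Commute a b := by
  obtain ⟨n, ⟨e⟩⟩ := hT
  have h : (⟨a, ha⟩ * ⟨b, hb⟩ : T) = ⟨b, hb⟩ * ⟨a, ha⟩ :=
    e.injective (by rw [map_mul, map_mul, mul_comm])
  exact congrArg Subtype.val h

/-- A larger torus is abelian, so it centralizes the range and therefore lies in it. -/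
theorem isMaximalTorus_range {G ι : Type*} [Group G] [TopologicalSpace G] [T2Space G] [Finite ι]
    (φ : (ι → Circle) →* G) (hc : Continuous φ) (hi : Function.Injective φ)
    (hz : ∀ g, (∀ z, Commute g (φ z)) → g ∈ φ.range) : IsMaximalTorus φ.range :=
  ⟨isTorusSubgroup_range φ hc hi, fun _ hT hle _ hg =>
    hz _ fun z => hT.commute hg (hle ⟨z, rfl⟩)⟩

namespace HasAbsorbingTorus

theorem of_continuousMulEquiv {G H : Type*} [Group G] [TopologicalSpace G] [Group H]
    [TopologicalSpace H] (e : G ≃ₜ* H) (hH : HasAbsorbingTorus H) : HasAbsorbingTorus G := by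
  obtain ⟨ι, hι, φ, hc, hi, hz, hA⟩ := hH
  refine ⟨ι, hι, e.symm.toMulEquiv.toMonoidHom.comp φ, e.symm.continuous.comp hc,
    e.symm.injective.comp hi, fun g hg => ?_, fun A hcomm => ?_⟩
  · obtain ⟨w, hw⟩ := hz (e g) fun z => by
      have h : Commute (e g) (e (e.symm (φ z))) := (hg z).map e
      rwa [e.apply_symm_apply] at h
    exact ⟨w, (congrArg e.symm hw).trans (e.symm_apply_apply g)⟩
  · obtain ⟨g, hg⟩ := hA (e '' A) (by
      rintro _ ⟨a, ha, rfl⟩ _ ⟨b, hb, rfl⟩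
      exact (hcomm a ha b hb).map e)
    refine ⟨e.symm g, fun a ha => ?_⟩
    obtain ⟨w, hw⟩ := hg (e a) ⟨a, ha, rfl⟩
    refine ⟨w, (congrArg e.symm hw).trans ?_⟩
    rw [map_mul, map_mul, map_inv, e.symm_apply_apply]

theorem prod {G H : Type*} [Group G] [TopologicalSpace G] [Group H]
    [TopologicalSpace H] (hG : HasAbsorbingTorus G) (hH : HasAbsorbingTorus H) :
    HasAbsorbingTorus (G × H) := by
  obtain ⟨ι, _, φ, hc, hi, hz, hA⟩ := hG
  obtain ⟨κ, _, ψ, hc', hi', hz', hA'⟩ := hH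
  let p : (ι ⊕ κ → Circle) →* (ι → Circle) :=
    { toFun := fun z i => z (.inl i), map_one' := rfl, map_mul' := fun _ _ => rfl }
  let q : (ι ⊕ κ → Circle) →* (κ → Circle) :=
    { toFun := fun z i => z (.inr i), map_one' := rfl, map_mul' := fun _ _ => rfl }
  have hp : Continuous p := continuous_pi fun i => continuous_apply _
  have hq : Continuous q := continuous_pi fun i => continuous_apply _
  have hmem : ∀ x : G × H, x.1 ∈ φ.range → x.2 ∈ ψ.range →
      x ∈ ((φ.comp p).prod (ψ.comp q)).range := by
    rintro ⟨_, _⟩ ⟨z, rfl⟩ ⟨w, rfl⟩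
    exact ⟨Sum.elim z w, rfl⟩
  refine ⟨ι ⊕ κ, inferInstance, (φ.comp p).prod (ψ.comp q),
    (hc.comp hp).prodMk (hc'.comp hq), fun z w h => ?_, fun g hg => hmem _ ?_ ?_,
    fun A hcomm => ?_⟩
  · have h1 := hi (congrArg Prod.fst h)
    have h2 := hi' (congrArg Prod.snd h)
    funext i
    rcases i with i | i
    · exact congrFun h1 i
    · exact congrFun h2 i
  · exact hz _ fun z => (hg (Sum.elim z 1)).map (MonoidHom.fst G H)
  · exact hz' _ fun z => (hg (Sum.elim 1 z)).map (MonoidHom.snd G H)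
  · obtain ⟨g, hg⟩ := hA (Prod.fst '' A) (by
      rintro _ ⟨a, ha, rfl⟩ _ ⟨b, hb, rfl⟩
      exact (hcomm a ha b hb).map (MonoidHom.fst G H))
    obtain ⟨h, hh⟩ := hA' (Prod.snd '' A) (by
      rintro _ ⟨a, ha, rfl⟩ _ ⟨b, hb, rfl⟩
      exact (hcomm a ha b hb).map (MonoidHom.snd G H))
    exact ⟨(g, h), fun a ha => hmem _ (hg _ ⟨a, ha, rfl⟩) (hh _ ⟨a, ha, rfl⟩)⟩

theorem pi {κ : Type} [Finite κ] {G : κ → Type*} [∀ k, Group (G k)]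
    [∀ k, TopologicalSpace (G k)] (hG : ∀ k, HasAbsorbingTorus (G k)) :
    HasAbsorbingTorus (∀ k, G k) := by
  classical
  choose ι hι φ hc hi hz hA using hG
  let p (k : κ) : ((Σ k, ι k) → Circle) →* (ι k → Circle) :=
    { toFun := fun z i => z ⟨k, i⟩, map_one' := rfl, map_mul' := fun _ _ => rfl }
  have hp (k) : Continuous (p k) := continuous_pi fun i => continuous_apply _
  have hmem : ∀ x : ∀ k, G k, (∀ k, x k ∈ (φ k).range) →
      x ∈ (MonoidHom.pi fun k => (φ k).comp (p k)).range := by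
    intro x hx
    choose z hz using hx
    exact ⟨fun i => z i.1 i.2, funext hz⟩
  refine ⟨Σ k, ι k, inferInstance, MonoidHom.pi fun k => (φ k).comp (p k),
    continuous_pi fun k => (hc k).comp (hp k), fun z w h => ?_, fun g hg => hmem _ fun k => ?_,
    fun A hcomm => ?_⟩
  · funext ⟨k, i⟩
    exact congrFun (hi k (congrFun h k)) i
  · refine hz k _ fun z => ?_
    -- Extending `z` by `1` on the other factors tests commutation in the `k`-th factor alone.
    let w : (Σ k, ι k) → Circle := fun i => if h : i.1 = k then z (h ▸ i.2) else 1
    have hw : p k w = z := by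
      funext i
      simp [p, w]
    rw [← hw]
    exact (hg w).map (Pi.evalMonoidHom G k)
  · have h (k) := hA k ((fun x => x k) '' A) (by
      rintro _ ⟨a, ha, rfl⟩ _ ⟨b, hb, rfl⟩
      exact (hcomm a ha b hb).map (Pi.evalMonoidHom G k))
    choose g hg using h
    exact ⟨g, fun a ha => hmem _ fun k => hg k _ ⟨a, ha, rfl⟩⟩

/-- In a Hausdorff group with an absorbing torus, the centralizer of a commuting subset is
connected and contains a maximal torus. -/
theorem isConnected_centralizer {G : Type*} [Group G] [TopologicalSpace G]
    [IsTopologicalGroup G] [T2Space G] (hG : HasAbsorbingTorus G) (A : Set G)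
    (hcomm : ∀ a ∈ A, ∀ b ∈ A, Commute a b) :
    IsConnected (Subgroup.centralizer A : Set G) ∧
      ∃ T : Subgroup G, IsMaximalTorus T ∧ T ≤ Subgroup.centralizer A := by
  obtain ⟨ι, _, φ, hc, hi, hz, hA⟩ := hG
  let ψ (g : G) : (ι → Circle) →* G := (MulAut.conj g).toMonoidHom.comp φ
  have hψ (g z) : ψ g z = g * φ z * g⁻¹ := rfl
  have hψc (g) : Continuous (ψ g) := (continuous_const.mul hc).mul continuous_const
  have hmem {g a : G} (h : g⁻¹ * a * g ∈ φ.range) : a ∈ (ψ g).range := by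
    obtain ⟨z, hz⟩ := h
    exact ⟨z, by rw [hψ, hz]; group⟩
  have hle {B : Set G} {g : G} (h : ∀ a ∈ B, g⁻¹ * a * g ∈ φ.range) :
      (ψ g).range ≤ Subgroup.centralizer B := by
    rintro _ ⟨z, rfl⟩
    rw [Subgroup.mem_centralizer_iff]
    intro a ha
    obtain ⟨w, rfl⟩ := hmem (h a ha)
    rw [← map_mul, ← map_mul, mul_comm]
  refine ⟨⟨⟨1, one_mem _⟩, isPreconnected_of_forall 1 fun g hg => ?_⟩, ?_⟩
  · have hg' : ∀ a ∈ A, Commute a g := Subgroup.mem_centralizer_iff.1 hg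
    -- One conjugate of the torus contains both `g` and `A`; it is the connected set joining `1` to
    -- `g` inside the centralizer.
    obtain ⟨h, hh⟩ := hA (insert g A) (by
      rintro a (rfl | ha) b (rfl | hb)
      · exact Commute.refl _
      · exact (hg' b hb).symm
      · exact hg' a ha
      · exact hcomm a ha b hb)
    refine ⟨(ψ h).range, hle fun a ha => hh a (Set.mem_insert_of_mem _ ha), one_mem _,
      hmem (hh g (Set.mem_insert _ _)), ?_⟩
    rw [MonoidHom.coe_range]
    exact isPreconnected_range (hψc h)
  · obtain ⟨g, hg⟩ := hA A hcomm
    refine ⟨(ψ g).range, isMaximalTorus_range _ (hψc g)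
      ((MulAut.conj g).injective.comp hi) fun x hx => hmem (hz _ fun z => ?_), hle hg⟩
    have h : g⁻¹ * (x * (g * φ z * g⁻¹)) * g = g⁻¹ * ((g * φ z * g⁻¹) * x) * g :=
      congrArg (fun y => g⁻¹ * y * g) (hx z).eq
    have h1 : g⁻¹ * (x * (g * φ z * g⁻¹)) * g = g⁻¹ * x * g * φ z := by group
    have h2 : g⁻¹ * ((g * φ z * g⁻¹) * x) * g = φ z * (g⁻¹ * x * g) := by group
    rw [h1, h2] at h
    exact h

theorem hasConnectedMaximalRankIsotropy {π G : Type*} [CommGroup π] [Group G]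
    [TopologicalSpace G] [IsTopologicalGroup G] [T2Space G] (hG : HasAbsorbingTorus G) :
    HasConnectedMaximalRankIsotropy G (HomSpace π G) := by
  intro f
  have h : MulAction.stabilizer G f = Subgroup.centralizer (Set.range f) := by
    ext g
    rw [MulAction.mem_stabilizer_iff, Subgroup.mem_centralizer_iff, Set.forall_mem_range,
      DFunLike.ext_iff]
    refine forall_congr' fun x => ?_
    rw [HomSpace.smul_apply, mul_inv_eq_iff_eq_mul, eq_comm]
  rw [h]
  refine hG.isConnected_centralizer _ ?_
  rintro _ ⟨x, rfl⟩ _ ⟨y, rfl⟩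
  exact (Commute.all x y).map f

end HasAbsorbingTorus

/-! ### Simultaneous unitary diagonalization over a star division ring -/

namespace Matrix

section Block

variable {K : Type*} [Ring K] {n : ℕ}

/-- The block diagonal matrix with blocks `x` (of size one) and `M`. -/
def consBlock (x : K) (M : Matrix (Fin n) (Fin n) K) : Matrix (Fin (n + 1)) (Fin (n + 1)) K :=
  of (Fin.cons (Fin.cons x 0) fun i => Fin.cons 0 (M i))

theorem consBlock_mul (x y : K) (M N : Matrix (Fin n) (Fin n) K) :
    consBlock x M * consBlock y N = consBlock (x * y) (M * N) := by
  ext i j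
  cases i using Fin.cases <;> cases j using Fin.cases <;>
    simp [consBlock, mul_apply, Fin.sum_univ_succ]

theorem star_consBlock [StarRing K] (x : K) (M : Matrix (Fin n) (Fin n) K) :
    star (consBlock x M) = consBlock (star x) (star M) := by
  ext i j
  cases i using Fin.cases <;> cases j using Fin.cases <;> simp [consBlock, star_apply]

theorem consBlock_diagonal (x : K) (d : Fin n → K) :
    consBlock x (diagonal d) = diagonal (Fin.cons x d : Fin (n + 1) → K) := by
  ext i j
  cases i using Fin.cases <;> cases j using Fin.cases <;>
    simp [consBlock, diagonal_apply, Fin.succ_ne_zero, (Fin.succ_ne_zero _).symm]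

theorem consBlock_one : consBlock (1 : K) (1 : Matrix (Fin n) (Fin n) K) = 1 := by
  rw [← diagonal_one, consBlock_diagonal, ← diagonal_one]
  congr 1
  ext i
  cases i using Fin.cases <;> simp

theorem consBlock_inj {x y : K} {M N : Matrix (Fin n) (Fin n) K} :
    consBlock x M = consBlock y N ↔ x = y ∧ M = N := by
  refine ⟨fun h => ⟨congrFun (congrFun h 0) 0, ?_⟩, by rintro ⟨rfl, rfl⟩; rfl⟩
  ext i j
  exact congrFun (congrFun h i.succ) j.succ

theorem consBlock_mem_unitary [StarRing K] {x : K} {M : Matrix (Fin n) (Fin n) K} :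
    consBlock x M ∈ unitary (Matrix (Fin (n + 1)) (Fin (n + 1)) K) ↔
      x ∈ unitary K ∧ M ∈ unitary (Matrix (Fin n) (Fin n) K) := by
  simp only [Unitary.mem_iff, star_consBlock, consBlock_mul, ← consBlock_one (K := K) (n := n),
    consBlock_inj]
  tauto

end Block

variable {K : Type*} [DivisionRing K] [StarRing K]

/-- A unitary matrix with an eigenvector `e₀` is block diagonal. -/
theorem exists_eq_consBlock {n : ℕ} {b : Matrix (Fin (n + 1)) (Fin (n + 1)) K}
    (hb : b ∈ unitary (Matrix (Fin (n + 1)) (Fin (n + 1)) K)) {x : K}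
    (hx : b *ᵥ Pi.single 0 1 = Pi.single 0 x) : ∃ M, b = consBlock x M := by
  -- Since `b` is unitary, `star b` also preserves the line of `e₀`. As `x ≠ 0`, this clears the
  -- rest of the first row of `b`, while `hx` clears the rest of the first column.
  have h1 : Pi.single 0 1 = star b *ᵥ Pi.single 0 x := by
    rw [← hx, mulVec_mulVec, Unitary.star_mul_self_of_mem hb, one_mulVec]
  rw [mulVec_single] at h1
  rw [mulVec_single_one] at hx
  have hx0 : x ≠ 0 := by
    rintro rfl
    simpa using congrFun h1 0
  refine ⟨of fun i j => b i.succ j.succ, ?_⟩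
  ext i j
  cases i using Fin.cases with
  | zero =>
    cases j using Fin.cases with
    | zero => simpa [consBlock] using congrFun hx 0
    | succ j => simpa [consBlock, hx0] using (congrFun h1 j.succ).symm
  | succ i =>
    cases j using Fin.cases with
    | zero => simpa [consBlock] using congrFun hx i.succ
    | succ j => simp [consBlock]

/-- The unitary group over a star division ring acts transitively on unit vectors. -/
theorem exists_unitary_mulVec_single {ι : Type*} [Fintype ι] [DecidableEq ι] (i : ι) {v : ι → K}
    (hv : star v ⬝ᵥ v = 1) (hv1 : v i = 1 → v = Pi.single i 1) :
    ∃ U ∈ unitary (Matrix ι ι K), U *ᵥ Pi.single i 1 = v := by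
  by_cases h1 : v i = 1
  · exact ⟨1, one_mem _, by rw [one_mulVec, hv1 h1]⟩
  have hc : 1 - v i ≠ 0 := sub_ne_zero.2 (Ne.symm h1)
  have hc' : 1 - star (v i) ≠ 0 := by
    rw [← star_one, ← star_sub]
    exact star_ne_zero.2 hc
  -- The matrix is the quasi-reflection `1 - w c w⋆`. The choice of `c` gives `w⋆ eᵢ = -c⁻¹`, so
  -- `eᵢ` goes to `eᵢ + w = v`. Unitarity amounts to `w⋆ w = c⁻¹ + (star c)⁻¹`, used with `c` and
  -- `star c` on either side; no commutativity is needed.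
  set w : ι → K := v - Pi.single i 1 with hw
  set c : K := (1 - star (v i))⁻¹ with hcdef
  have hsc : star c = (1 - v i)⁻¹ := by simp [hcdef, star_inv₀]
  have hww : star w ⬝ᵥ w = (1 - star (v i)) + (1 - v i) := by
    simp [hw, hv, sub_dotProduct, dotProduct_sub]
    abel
  have hcw : c * (star w ⬝ᵥ w) * star c = c + star c := by
    rw [hww, hsc, mul_add, add_mul, inv_mul_cancel₀ hc', mul_assoc, mul_inv_cancel₀ hc]
    simp [add_comm]
  have hwc : star c * (star w ⬝ᵥ w) * c = c + star c := by
    rw [hww, hsc, add_comm, mul_add, add_mul, inv_mul_cancel₀ hc, mul_assoc, mul_inv_cancel₀ hc']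
    simp
  have hmul (x y : K) : vecMulVec w (x • star w) * vecMulVec w (y • star w) =
      vecMulVec w ((x * (star w ⬝ᵥ w) * y) • star w) := by
    rw [vecMulVec_mul_vecMulVec]
    simp [smul_smul, smul_dotProduct]
  have hstar (x : K) : star (vecMulVec w (x • star w)) = vecMulVec w (star x • star w) := by
    ext a b
    simp [vecMulVec_apply, star_apply, mul_assoc]
  have hadd (x y : K) : vecMulVec w (x • star w) + vecMulVec w (y • star w) =
      vecMulVec w ((x + y) • star w) := by
    rw [add_smul, vecMulVec_add]
  refine ⟨1 - vecMulVec w (c • star w), Unitary.mem_iff.2 ⟨?_, ?_⟩, ?_⟩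
  · rw [star_sub (1 : Matrix ι ι K), star_one, hstar, sub_mul, one_mul, mul_sub, mul_one, hmul, hwc, ← hadd]
    abel
  · rw [star_sub (1 : Matrix ι ι K), star_one, hstar, sub_mul, one_mul, mul_sub, mul_one, hmul, hcw, ← hadd]
    abel
  · have : c * (star (v i) - 1) = -1 := by
      rw [← neg_sub, mul_neg, inv_mul_cancel₀ hc']
    ext j
    rw [sub_mulVec, one_mulVec, mulVec_single_one]
    simp [vecMulVec_apply, hw, this]

open MulOpposite in
/-- If commuting sets of unitary matrices have common unit right eigenvectors with eigenvalues
in `S`, then they are simultaneously diagonalizable with diagonal entries in `S`. -/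
theorem exists_unitary_forall_eq_diagonal (S : Set K)
    (hdef : ∀ (n : ℕ) (v : Fin n → K) (i : Fin n), star v ⬝ᵥ v = 1 → v i = 1 → v = Pi.single i 1)
    (heig : ∀ (n : ℕ) (A : Set (Matrix (Fin (n + 1)) (Fin (n + 1)) K)),
      (∀ a ∈ A, ∀ b ∈ A, Commute a b) →
        ∃ v : Fin (n + 1) → K, star v ⬝ᵥ v = 1 ∧ ∀ a ∈ A, ∃ x ∈ S, a *ᵥ v = op x • v)
    (n : ℕ) (A : Set (Matrix (Fin n) (Fin n) K))
    (hA : ∀ a ∈ A, a ∈ unitary (Matrix (Fin n) (Fin n) K))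
    (hcomm : ∀ a ∈ A, ∀ b ∈ A, Commute a b) :
    ∃ U ∈ unitary (Matrix (Fin n) (Fin n) K), ∀ a ∈ A, ∃ d : Fin n → K,
      (∀ i, d i ∈ S) ∧ star U * a * U = diagonal d := by
  induction n with
  | zero => exact ⟨1, one_mem _, fun a _ => ⟨0, fun i => i.elim0, Subsingleton.elim _ _⟩⟩
  | succ n ih =>
    obtain ⟨v, hv, hAv⟩ := heig n A hcomm
    obtain ⟨U, hU, hUv⟩ := exists_unitary_mulVec_single 0 hv (hdef _ v 0 hv)
    have hUU := Unitary.star_mul_self_of_mem hU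
    have hUU' := Unitary.mul_star_self_of_mem hU
    have hconj : ∀ a ∈ A, ∃ x ∈ S, ∃ M, star U * a * U = consBlock x M := by
      intro a ha
      obtain ⟨x, hx, hax⟩ := hAv a ha
      refine ⟨x, hx, exists_eq_consBlock
        (mul_mem (mul_mem (Unitary.star_mem hU) (hA a ha)) hU) ?_⟩
      rw [← mulVec_mulVec, ← mulVec_mulVec, hUv, hax, mulVec_smul, ← hUv, mulVec_mulVec, hUU,
        one_mulVec]
      ext i
      cases i using Fin.cases <;> simp
    -- The lower blocks of the conjugated matrices again form a commuting set of unitary matrices.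
    let B : Set (Matrix (Fin n) (Fin n) K) :=
      {M | ∃ a ∈ A, ∃ x, star U * a * U = consBlock x M}
    have hmul (a b) : star U * a * U * (star U * b * U) = star U * (a * b) * U := by
      calc _ = star U * a * (U * star U) * b * U := by simp only [mul_assoc]
        _ = _ := by rw [hUU', mul_one]; simp only [mul_assoc]
    obtain ⟨V, hV, hBV⟩ := ih B
      (by
        rintro M ⟨a, ha, x, h⟩
        have := mul_mem (mul_mem (Unitary.star_mem hU) (hA a ha)) hU
        rw [h, consBlock_mem_unitary] at this
        exact this.2)
      (by
        rintro M ⟨a, ha, x, h⟩ N ⟨b, hb, y, h'⟩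
        have h1 := hmul a b
        rw [(hcomm a ha b hb).eq, ← hmul b a, h, h', consBlock_mul, consBlock_mul,
          consBlock_inj] at h1
        exact h1.2)
    refine ⟨U * consBlock 1 V, mul_mem hU (consBlock_mem_unitary.2 ⟨one_mem _, hV⟩),
      fun a ha => ?_⟩
    obtain ⟨x, hx, M, hM⟩ := hconj a ha
    obtain ⟨d, hd, hMd⟩ := hBV M ⟨a, ha, x, hM⟩
    refine ⟨Fin.cons x d, fun i => ?_, ?_⟩
    · cases i using Fin.cases with
      | zero => exact hx
      | succ i => exact hd i
    · calc _ = star (consBlock 1 V) * (star U * a * U) * consBlock 1 V := by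
            rw [star_mul]; simp only [mul_assoc]
        _ = _ := by
          rw [hM, star_consBlock, consBlock_mul, consBlock_mul, hMd, consBlock_diagonal]
          simp

end Matrix

/-- A commuting set of endomorphisms of a nonzero finite-dimensional complex vector space has a
common eigenvector. -/
theorem Module.End.exists_common_eigenvector {V : Type*} [AddCommGroup V] [Module ℂ V]
    [FiniteDimensional ℂ V] [Nontrivial V] (A : Set (Module.End ℂ V))
    (hcomm : ∀ a ∈ A, ∀ b ∈ A, Commute a b) :
    ∃ v : V, v ≠ 0 ∧ ∀ a ∈ A, ∃ x : ℂ, a v = x • v := by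
  -- In a minimal nonzero invariant subspace every `a ∈ A` is scalar: its eigenspace there is
  -- nonzero and, by commutation, invariant.
  let P : Set (Submodule ℂ V) := {W | W ≠ ⊥ ∧ ∀ a ∈ A, ∀ w ∈ W, a w ∈ W}
  have hP : P.Nonempty := ⟨⊤, top_ne_bot, fun _ _ _ _ => trivial⟩
  obtain ⟨W, ⟨hW0, hWA⟩, hmin⟩ := wellFounded_lt.has_min P hP
  obtain ⟨v, hv, hv0⟩ := W.exists_mem_ne_zero_of_ne_bot hW0
  refine ⟨v, hv0, fun a ha => ?_⟩
  have : Nontrivial W := Submodule.nontrivial_iff_ne_bot.2 hW0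
  obtain ⟨x, hx⟩ := Module.End.exists_eigenvalue (a.restrict (hWA a ha))
  obtain ⟨u, hu⟩ := hx.exists_hasEigenvector
  have hau : a u = x • (u : V) := congrArg Subtype.val hu.apply_eq_smul
  let W' : Submodule ℂ V := W ⊓ Module.End.eigenspace a x
  have hW' : W' ∈ P := by
    refine ⟨fun h => hu.2 (Subtype.ext ?_), fun b hb w hw => ⟨hWA b hb w hw.1, ?_⟩⟩
    · have : (u : V) ∈ W' := ⟨u.2, Module.End.mem_eigenspace_iff.2 hau⟩
      rw [h] at this
      exact (Submodule.mem_bot ℂ).1 this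
    · have hw2 := Module.End.mem_eigenspace_iff.1 hw.2
      refine Module.End.mem_eigenspace_iff.2 ?_
      have h : a (b w) = b (a w) := LinearMap.congr_fun (hcomm a ha b hb).eq w
      rw [h, hw2, map_smul]
  have hWW' : W' = W := by
    by_contra hne
    exact hmin W' hW' (lt_of_le_of_ne inf_le_left hne)
  rw [← hWW'] at hv
  exact ⟨x, Module.End.mem_eigenspace_iff.1 hv.2⟩

/-! ### The absorbing tori of the groups `U(q)`, `Sp(k)` and `SU(r)` -/

section Definite

variable {K : Type*} [NormedDivisionRing K] [NormedAlgebra ℝ K] [StarRing K]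

/-- The hypothesis `hK`, satisfied by both `ℂ` and `ℍ`, makes the Hermitian form positive definite.
-/
theorem star_dotProduct_self_eq_algebraMap
    (hK : ∀ x : K, star x * x = algebraMap ℝ K (‖x‖ ^ 2)) {ι : Type*} [Fintype ι] (v : ι → K) :
    star v ⬝ᵥ v = algebraMap ℝ K (∑ i, ‖v i‖ ^ 2) := by
  simp [dotProduct, hK]

theorem eq_single_of_star_dotProduct_self_eq_one
    (hK : ∀ x : K, star x * x = algebraMap ℝ K (‖x‖ ^ 2)) {ι : Type*} [Fintype ι] [DecidableEq ι]
    {v : ι → K} {i : ι} (hv : star v ⬝ᵥ v = 1) (hi : v i = 1) : v = Pi.single i 1 := by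
  rw [star_dotProduct_self_eq_algebraMap hK, ← map_one (algebraMap ℝ K)] at hv
  have h := (algebraMap ℝ K).injective hv
  rw [← Finset.add_sum_erase _ _ (Finset.mem_univ i), hi, norm_one, one_pow, add_eq_left,
    Finset.sum_eq_zero_iff_of_nonneg fun _ _ => by positivity] at h
  ext j
  by_cases hj : j = i
  · subst hj
    simp [hi]
  · simpa [hj] using h j (by simp [hj])

theorem exists_smul_star_dotProduct_self_eq_one
    (hK : ∀ x : K, star x * x = algebraMap ℝ K (‖x‖ ^ 2)) {ι : Type*} [Fintype ι]
    {v : ι → K} (hv : v ≠ 0) : ∃ r : ℝ, star (r • v) ⬝ᵥ (r • v) = 1 := by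
  obtain ⟨i, hi⟩ := Function.ne_iff.1 hv
  have hs : 0 < ∑ i, ‖v i‖ ^ 2 := Finset.sum_pos' (fun _ _ => by positivity)
    ⟨i, Finset.mem_univ i, by have := norm_pos_iff.2 hi; positivity⟩
  refine ⟨(√(∑ i, ‖v i‖ ^ 2))⁻¹, ?_⟩
  rw [star_dotProduct_self_eq_algebraMap hK, ← map_one (algebraMap ℝ K)]
  congr 1
  simp only [Pi.smul_apply, norm_smul, mul_pow, ← Finset.mul_sum, norm_inv, inv_pow,
    Real.norm_eq_abs, sq_abs, Real.sq_sqrt hs.le]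
  exact inv_mul_cancel₀ hs.ne'

-- Left multiplication by a matrix commutes with right scalars, so letting `ℂ` act on the right
-- through `f` makes the matrices complex linear, and the common eigenvector over `ℂ` applies.
-- Rescaling by a real number keeps the eigenvalues.
open MulOpposite in
theorem Matrix.exists_common_unit_eigenvector [FiniteDimensional ℝ K] (f : ℂ →ₐ[ℝ] K)
    (hK : ∀ x : K, star x * x = algebraMap ℝ K (‖x‖ ^ 2)) {ι : Type*} [Fintype ι] [Nonempty ι]
    (A : Set (Matrix ι ι K)) (hcomm : ∀ a ∈ A, ∀ b ∈ A, Commute a b) :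
    ∃ v : ι → K, star v ⬝ᵥ v = 1 ∧ ∀ a ∈ A, ∃ x ∈ Set.range f, a *ᵥ v = op x • v := by
  let g : ℂ →+* Kᵐᵒᵖ := f.toRingHom.toOpposite fun x y => (Commute.all x y).map f
  let _ : Module ℂ (ι → K) := Module.compHom (ι → K) g
  have hsmul (z : ℂ) (v : ι → K) : z • v = op (f z) • v := rfl
  have : IsScalarTower ℝ ℂ (ι → K) := ⟨fun r z v => by
    rw [hsmul, hsmul]
    ext i
    simp [← Algebra.smul_def]⟩
  have : FiniteDimensional ℂ (ι → K) := Module.Finite.of_restrictScalars_finite ℝ ℂ (ι → K)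
  let F (a : Matrix ι ι K) : Module.End ℂ (ι → K) :=
    { toFun := fun v => a *ᵥ v
      map_add' := mulVec_add a
      map_smul' := fun z v => mulVec_smul a (op (f z)) v }
  obtain ⟨v, hv, hAv⟩ := Module.End.exists_common_eigenvector (F '' A) (by
    rintro _ ⟨a, ha, rfl⟩ _ ⟨b, hb, rfl⟩
    refine LinearMap.ext fun v => ?_
    change a *ᵥ (b *ᵥ v) = b *ᵥ (a *ᵥ v)
    rw [mulVec_mulVec, mulVec_mulVec, (hcomm a ha b hb).eq])
  obtain ⟨r, hr⟩ := exists_smul_star_dotProduct_self_eq_one hK hv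
  refine ⟨r • v, hr, fun a ha => ?_⟩
  obtain ⟨x, hx⟩ := hAv (F a) ⟨a, ha, rfl⟩
  refine ⟨f x, ⟨x, rfl⟩, ?_⟩
  have hx' : a *ᵥ v = op (f x) • v := hx
  rw [mulVec_smul, hx', smul_comm]

theorem Matrix.exists_unitary_forall_eq_diagonal_range [FiniteDimensional ℝ K] (f : ℂ →ₐ[ℝ] K)
    (hK : ∀ x : K, star x * x = algebraMap ℝ K (‖x‖ ^ 2)) {n : ℕ}
    (A : Set (unitary (Matrix (Fin n) (Fin n) K))) (hcomm : ∀ a ∈ A, ∀ b ∈ A, Commute a b) :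
    ∃ U : unitary (Matrix (Fin n) (Fin n) K), ∀ a ∈ A, ∃ d : Fin n → ℂ,
      (↑(U⁻¹ * a * U) : Matrix (Fin n) (Fin n) K) = diagonal fun i => f (d i) := by
  obtain ⟨U, hU, h⟩ := exists_unitary_forall_eq_diagonal (Set.range f)
    (fun _ _ _ => eq_single_of_star_dotProduct_self_eq_one hK)
    (fun _ B hB => exists_common_unit_eigenvector f hK B hB) n (Subtype.val '' A)
    (by rintro _ ⟨a, -, rfl⟩; exact a.2)
    (by
      rintro _ ⟨a, ha, rfl⟩ _ ⟨b, hb, rfl⟩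
      exact congrArg Subtype.val (hcomm a ha b hb).eq)
  refine ⟨⟨U, hU⟩, fun a ha => ?_⟩
  obtain ⟨d, hd, hdiag⟩ := h a ⟨a, ha, rfl⟩
  choose z hz using hd
  refine ⟨z, ?_⟩
  simp only [hz]
  exact hdiag

theorem Matrix.norm_eq_one_of_diagonal_mem_unitary (f : ℂ →ₐ[ℝ] K)
    (hf : ∀ z, star (f z) = f (star z)) {n : ℕ} {d : Fin n → ℂ}
    (hd : (diagonal fun i => f (d i)) ∈ unitary (Matrix (Fin n) (Fin n) K)) (i : Fin n) :
    ‖d i‖ = 1 := by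
  have h0 := Unitary.star_mul_self_of_mem hd
  rw [star_eq_conjTranspose, diagonal_conjTranspose, diagonal_mul_diagonal, ← diagonal_one] at h0
  have h := congrFun (diagonal_injective h0) i
  rw [Pi.star_apply, hf, ← map_mul, ← map_one f] at h
  have h' := f.toRingHom.injective h
  rw [Complex.star_def, Complex.conj_mul'] at h'
  exact (pow_eq_one_iff_of_nonneg (norm_nonneg _) two_ne_zero).1 (by exact_mod_cast h')

theorem Matrix.diagonal_mem_unitary (f : ℂ →ₐ[ℝ] K) (hf : ∀ z, star (f z) = f (star z)) {n : ℕ}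
    (z : Fin n → Circle) :
    (diagonal fun i => f (z i)) ∈ unitary (Matrix (Fin n) (Fin n) K) := by
  rw [Unitary.mem_iff, star_eq_conjTranspose, diagonal_conjTranspose, diagonal_mul_diagonal,
    diagonal_mul_diagonal, ← diagonal_one]
  constructor <;> congr 1 <;> ext i <;>
    simp only [Pi.star_apply, hf, ← map_mul, Complex.star_def, Complex.conj_mul',
      Complex.mul_conj', Circle.norm_coe, Complex.ofReal_one, one_pow, map_one]

/-- The homomorphism from `(S¹)ⁿ` to the unitary group which sends `z` to the diagonal matrix
with entries `f (z i)`. -/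
noncomputable def Matrix.diagonalTorusHom (f : ℂ →ₐ[ℝ] K) (hf : ∀ z, star (f z) = f (star z)) (n : ℕ) :
    (Fin n → Circle) →* unitary (Matrix (Fin n) (Fin n) K) where
  toFun z := ⟨diagonal fun i => f (z i), diagonal_mem_unitary f hf z⟩
  map_one' := Subtype.ext (by simp)
  map_mul' z w := Subtype.ext (by simp)

theorem Matrix.mem_range_diagonalTorusHom (f : ℂ →ₐ[ℝ] K) (hf : ∀ z, star (f z) = f (star z))
    {n : ℕ} {g : unitary (Matrix (Fin n) (Fin n) K)} {d : Fin n → ℂ}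
    (hd : (g : Matrix (Fin n) (Fin n) K) = diagonal fun i => f (d i)) :
    g ∈ (diagonalTorusHom f hf n).range := by
  have h := norm_eq_one_of_diagonal_mem_unitary f hf (hd ▸ g.2)
  exact ⟨fun i => ⟨d i, mem_sphere_zero_iff_norm.2 (h i)⟩, Subtype.ext hd.symm⟩

/-- A matrix centralizing the diagonal torus is diagonal because sign matrices kill its off-diagonal
entries; commuting with the constant diagonal `f(I)` puts the diagonal entries in the range of `f`.
-/
theorem hasAbsorbingTorus_unitary [FiniteDimensional ℝ K] (f : ℂ →ₐ[ℝ] K) (hfc : Continuous f)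
    (hf : ∀ z, star (f z) = f (star z))
    (hK : ∀ x : K, star x * x = algebraMap ℝ K (‖x‖ ^ 2))
    (hcent : ∀ x : K, Commute x (f Complex.I) → x ∈ Set.range f) (n : ℕ) :
    HasAbsorbingTorus (unitary (Matrix (Fin n) (Fin n) K)) := by
  refine ⟨Fin n, inferInstance, Matrix.diagonalTorusHom f hf n, ?_, fun z w h => ?_,
    fun g hg => ?_, fun A hA => ?_⟩
  · refine Continuous.subtype_mk (Continuous.matrix_diagonal (continuous_pi fun i => ?_)) _
    exact hfc.comp (continuous_subtype_val.comp (continuous_apply i))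
  · funext i
    exact Subtype.ext (f.toRingHom.injective
      (congrFun (Matrix.diagonal_injective (congrArg Subtype.val h)) i))
  · have hcomm (z : Fin n → Circle) (i j : Fin n) :
        (g : Matrix (Fin n) (Fin n) K) i j * f (z j) = f (z i) * (g : Matrix _ _ K) i j := by
      have h := congrFun (congrFun (congrArg Subtype.val (hg z).eq) i) j
      simpa [Matrix.diagonalTorusHom] using h
    have hdiag (i : Fin n) : ∃ x, f x = (g : Matrix (Fin n) (Fin n) K) i i :=
      hcent _ (hcomm (fun _ => ⟨Complex.I, by simp [Submonoid.unitSphere]⟩) i i)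
    choose d hd using hdiag
    refine Matrix.mem_range_diagonalTorusHom f hf (d := d) ?_
    ext i j
    by_cases hij : i = j
    · subst hij
      simp [hd]
    · let z : Fin n → Circle := Pi.mulSingle i (-1)
      have hi : f (z i) = -1 := by simp [z]
      have hj : f (z j) = 1 := by simp [z, Ne.symm hij]
      have h := hcomm z i j
      rw [hi, hj, mul_one, neg_one_mul] at h
      have h2 : (2 : ℝ) • (g : Matrix (Fin n) (Fin n) K) i j = 0 := by
        rw [two_smul, ← eq_neg_iff_add_eq_zero]
        exact h
      rw [Matrix.diagonal_apply_ne _ hij]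
      exact (smul_eq_zero.1 h2).resolve_left two_ne_zero
  · obtain ⟨U, hU⟩ := Matrix.exists_unitary_forall_eq_diagonal_range f hK A hA
    refine ⟨U, fun a ha => ?_⟩
    obtain ⟨d, hd⟩ := hU a ha
    exact Matrix.mem_range_diagonalTorusHom f hf hd

end Definite

/-! ### The unitary and symplectic groups -/

theorem Complex.star_mul_self_eq_algebraMap (x : ℂ) :
    star x * x = algebraMap ℝ ℂ (‖x‖ ^ 2) := by
  rw [Complex.star_def, Complex.conj_mul']
  simp

theorem hasAbsorbingTorus_uGroup (q : ℕ) : HasAbsorbingTorus (UGroup q) :=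
  hasAbsorbingTorus_unitary (AlgHom.id ℝ ℂ) continuous_id (fun _ => rfl)
    Complex.star_mul_self_eq_algebraMap (fun x _ => ⟨x, rfl⟩) q

theorem hasAbsorbingTorus_spGroup (k : ℕ) : HasAbsorbingTorus (SpGroup k) := by
  refine hasAbsorbingTorus_unitary Quaternion.ofComplex
    Quaternion.ofComplex.toLinearMap.continuous_of_finiteDimensional
    (fun z => ?_) (fun x => ?_) (fun x hx => ⟨⟨x.re, x.imI⟩, ?_⟩) k
  · ext <;> simp
  · rw [Quaternion.star_mul_self, Quaternion.normSq_eq_norm_mul_self, sq]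
    rfl
  -- Commuting with `i` forces the `j` and `k` components to vanish.
  · have h1 := congrArg QuaternionAlgebra.imJ hx.eq
    have h2 := congrArg QuaternionAlgebra.imK hx.eq
    simp at h1 h2
    ext <;> simp <;> linarith

/-! ### The special unitary groups -/

theorem Circle.coe_finsetProd {ι : Type*} (s : Finset ι) (z : ι → Circle) :
    ((∏ i ∈ s, z i : Circle) : ℂ) = ∏ i ∈ s, (z i : ℂ) :=
  map_prod Circle.coeHom z s

/-- The homomorphism from `(S¹)ⁿ` to `SU(n + 1)` which sends `z` to the diagonal matrix with
entries `(∏ i, z i)⁻¹, z 0, …, z (n - 1)`. -/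
noncomputable def specialDiagonalTorusHom (n : ℕ) : (Fin n → Circle) →* SUGroup (n + 1) where
  toFun z := ⟨Matrix.diagonal fun i => ((Fin.cons (∏ i, z i)⁻¹ z : Fin (n + 1) → Circle) i : ℂ),
    Matrix.mem_specialUnitaryGroup_iff.2
      ⟨Matrix.diagonal_mem_unitary (AlgHom.id ℝ ℂ) (fun _ => rfl) _, by
        rw [Matrix.det_diagonal, ← Circle.coe_finsetProd, Fin.prod_univ_succ]
        simp⟩⟩
  map_one' := Subtype.ext (by
    rw [Submonoid.coe_one, ← Matrix.diagonal_one]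
    refine congrArg Matrix.diagonal (funext fun i => ?_)
    cases i using Fin.cases <;> simp)
  map_mul' z w := Subtype.ext (by
    rw [Submonoid.coe_mul, Matrix.diagonal_mul_diagonal]
    refine congrArg Matrix.diagonal (funext fun i => ?_)
    cases i using Fin.cases <;> simp [Finset.prod_mul_distrib, mul_comm])

theorem specialDiagonalTorusHom_succ {n : ℕ} {z : Fin (n + 1) → Circle} (hz : ∏ i, z i = 1) :
    (specialDiagonalTorusHom n fun i => z i.succ).1 = Matrix.diagonal fun i => (z i : ℂ) := by
  rw [Fin.prod_univ_succ] at hz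
  refine congrArg Matrix.diagonal (funext fun i => ?_)
  cases i using Fin.cases with
  | zero => rw [Fin.cons_zero, ← eq_inv_of_mul_eq_one_left hz]
  | succ i => rfl

theorem mem_range_specialDiagonalTorusHom {n : ℕ} {g : SUGroup (n + 1)} {d : Fin (n + 1) → ℂ}
    (hd : (g : Matrix (Fin (n + 1)) (Fin (n + 1)) ℂ) = Matrix.diagonal d) :
    g ∈ (specialDiagonalTorusHom n).range := by
  obtain ⟨hu, hdet⟩ := Matrix.mem_specialUnitaryGroup_iff.1 g.2
  rw [hd] at hu
  have h := Matrix.norm_eq_one_of_diagonal_mem_unitary (AlgHom.id ℝ ℂ) (fun _ => rfl) hu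
  let z : Fin (n + 1) → Circle := fun i => ⟨d i, mem_sphere_zero_iff_norm.2 (h i)⟩
  have hz : ∏ i, z i = 1 := by
    apply Circle.coe_injective
    rw [hd, Matrix.det_diagonal] at hdet
    rw [Circle.coe_finsetProd, Circle.coe_one]
    exact hdet
  exact ⟨fun i => z i.succ, Subtype.ext ((specialDiagonalTorusHom_succ hz).trans hd.symm)⟩

theorem hasAbsorbingTorus_suGroup (r : ℕ) : HasAbsorbingTorus (SUGroup r) := by
  rcases r with _ | n
  -- The torus of `SU(n + 1)` has rank `n`, so the trivial group `SU(0)` needs a separate torus of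
  -- rank zero.
  · have : Subsingleton (SUGroup 0) := ⟨fun a b => Subtype.ext (Subsingleton.elim _ _)⟩
    refine ⟨Empty, inferInstance, 1, continuous_const, fun _ _ _ => Subsingleton.elim _ _,
      fun g _ => ⟨1, Subsingleton.elim _ _⟩, fun _ _ => ⟨1, fun _ _ => ⟨1, Subsingleton.elim _ _⟩⟩⟩
  refine ⟨Fin n, inferInstance, specialDiagonalTorusHom n, ?_, fun z w h => ?_, fun g hg => ?_,
    fun A hA => ?_⟩
  · refine Continuous.subtype_mk (Continuous.matrix_diagonal (continuous_pi fun i => ?_)) _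
    refine continuous_subtype_val.comp ?_
    cases i using Fin.cases with
    | zero => exact (continuous_finsetProd (M := Circle) Finset.univ fun i _ => continuous_apply i).inv
    | succ i => exact continuous_apply i
  · funext i
    exact Circle.coe_injective
      (congrFun (Matrix.diagonal_injective (congrArg Subtype.val h)) i.succ)
  · refine mem_range_specialDiagonalTorusHom (d := fun i => g.1 i i) ?_
    ext i j
    by_cases hij : i = j
    · subst hij
      simp
    · rw [Matrix.diagonal_apply_ne _ hij]
      obtain ⟨I, hI⟩ : ∃ I : Circle, (I : ℂ) = Complex.I :=
        ⟨⟨Complex.I, by simp [Submonoid.unitSphere]⟩, rfl⟩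
      -- A single sign change has determinant `-1`; the entries `I` and `I⁻¹ = -I` are distinct and
      -- have product one.
      let z : Fin (n + 1) → Circle := Pi.mulSingle i I * Pi.mulSingle j I⁻¹
      have hz : ∏ i, z i = 1 := by simp [z, Finset.prod_mul_distrib]
      have h := hg fun i => z i.succ
      have h' := congrFun (congrFun (congrArg Subtype.val h.eq) i) j
      rw [Submonoid.coe_mul, Submonoid.coe_mul, specialDiagonalTorusHom_succ hz, Matrix.mul_diagonal,
        Matrix.diagonal_mul] at h'
      have hi : (z i : ℂ) = Complex.I := by simp [z, hij, hI]
      have hj : (z j : ℂ) = -Complex.I := by simp [z, Ne.symm hij, hI]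
      rw [hi, hj, mul_comm] at h'
      have h2 : (2 * Complex.I) * g.1 i j = 0 := by linear_combination -h'
      simpa using h2
  · let ι : SUGroup (n + 1) →* UGroup (n + 1) :=
      Submonoid.inclusion Matrix.specialUnitaryGroup_le_unitaryGroup
    obtain ⟨U, hU⟩ := Matrix.exists_unitary_forall_eq_diagonal_range (AlgHom.id ℝ ℂ)
      Complex.star_mul_self_eq_algebraMap (ι '' A) (by
        rintro _ ⟨a, ha, rfl⟩ _ ⟨b, hb, rfl⟩
        exact (hA a ha b hb).map ι)
    have hdet := Matrix.det_of_mem_unitary U.2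
    -- Multiplying `U` on the right by `diag((det U)⁻¹, 1, …, 1)` gives determinant one, and
    -- conjugating by a diagonal matrix keeps the results diagonal.
    let c : Circle := ⟨U.1.det, mem_sphere_zero_iff_norm.2 (CStarRing.norm_of_mem_unitary hdet)⟩
    let D : UGroup (n + 1) :=
      Matrix.diagonalTorusHom (AlgHom.id ℝ ℂ) (fun _ => rfl) (n + 1) (Pi.mulSingle 0 c⁻¹)
    have hD : D.1 = Matrix.diagonal fun i => ((Pi.mulSingle 0 c⁻¹ : Fin (n + 1) → Circle) i : ℂ) :=
      rfl
    have hUD : (U * D).1.det = 1 := by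
      have h1 : D.1.det = (c⁻¹ : Circle) := by
        rw [hD, Matrix.det_diagonal, Fin.prod_univ_succ]
        simp
      have h2 : U.1.det = (c : ℂ) := rfl
      rw [Submonoid.coe_mul, Matrix.det_mul, h1, h2, ← Circle.coe_mul, mul_inv_cancel,
        Circle.coe_one]
    refine ⟨⟨(U * D).1, Matrix.mem_specialUnitaryGroup_iff.2 ⟨(U * D).2, hUD⟩⟩, fun a ha => ?_⟩
    obtain ⟨d, hd⟩ := hU (ι a) ⟨a, ha, rfl⟩
    have h : (U * D)⁻¹ * ι a * (U * D) = D⁻¹ * (U⁻¹ * ι a * U) * D := by group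
    refine mem_range_specialDiagonalTorusHom
      (d := fun i => star (D.1 i i) * d i * D.1 i i) ?_
    refine (congrArg Subtype.val h).trans ?_
    rw [Submonoid.coe_mul, Submonoid.coe_mul, hd, Matrix.UnitaryGroup.inv_val, hD,
      Matrix.star_eq_conjTranspose, Matrix.diagonal_conjTranspose, Matrix.diagonal_mul_diagonal,
      Matrix.diagonal_mul_diagonal]
    simp

theorem mainTheorem9 {π G : Type*} [CommGroup π] [Group.FG π]
    [Group G] [TopologicalSpace G] [IsTopologicalGroup G] (hG : InClassP G) :
    HasConnectedMaximalRankIsotropy G (HomSpace π G) := by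
  obtain ⟨a, b, c, r, q, k, ⟨e⟩⟩ := hG
  have : T2Space G := e.toHomeomorph.symm.t2Space
  exact ((((HasAbsorbingTorus.pi fun i => hasAbsorbingTorus_suGroup (r i)).prod
    ((HasAbsorbingTorus.pi fun j => hasAbsorbingTorus_uGroup (q j)).prod
      (HasAbsorbingTorus.pi fun l => hasAbsorbingTorus_spGroup (k l)))).of_continuousMulEquiv
        e).hasConnectedMaximalRankIsotropy)
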